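/- **Setting.** Let $U$ be a set of $n\ge 1$ elements. A permutation $\pi$ of $U$ assigns to each $e\in U$ a position in $\{1,\dots,n\}$. Given an initial permutation $\pi^0$ and non-empty requests $R_1,\dots,R_T\subseteq U$, Multistage Min-Sum Set Cover (Mult-MSSC) asks for permutations $\pi^1,\dots,\pi^T$ minimizing $$\sum_{t=1}^T \pi^t(R_t)+\sum_{t=1}^T \mathrm d_{\mathrm{KT}}(\pi^t,\pi^{t-1}),$$ where $\pi(R)$ is the position of the first element of $R$ in $\pi$ and $\mathrm d_{\mathrm{KT}}$ is the number of (unordered) pairs of elements that the two permutations order differently; $\mathrm{OPT}$ is the minimum. For $U\times\{1,\dots,n\}$ stochastic matrices $A,B$ let $\mathrm d_{\mathrm{FR}}(A,B)$ be the minimum of $\sum_{e,i,j}|i-j|f^e_{ij}$ over $f\ge 0$ with $\sum_i f^e_{ij}=B_{ej}$ and $\sum_j f^e_{ij}=A_{ei}$. Fractional-MTF is the problem of minimizing $\sum_{t=1}^T \mathrm d_{\mathrm{FR}}(A^t,A^{t-1})$ over sequences $A^0,A^1,\dots,A^T$ where $A^0$ is the 0-1 matrix of $\pi^0$ and, for $t\ge1$,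 $A^t$ is doubly stochastic with $\sum_{e\in R_t}A^t_{e1}=1$. The greedy rounding algorithm computes an optimal solution $A^0,\dots,A^T$ of Fractional-MTF and then, for $t=1,\dots,T$, obtains $\pi^t$ from $\pi^{t-1}$ by moving to the first position some element $e\in R_t$ with $A^t_{e1}\ge 1/r$. **Theorem.** There are absolute constants $C>0$ and $D\in\mathbb N$ such that for all such $U,\pi^0,R_1,\dots,R_T$ and every $r$ with $|R_t|\le r$ for all $t$: 1. Fractional-MTF has an optimal solution. 2. For every optimal solution $A$ of Fractional-MTF, each $R_t$ contains an element $e$ with $A^t_{e1}\ge 1/r$, so the rounding can be carried out; and, whatever admissible elements are chosen, the resulting sequence of permutations has cost at most $C\,r^2\cdot\mathrm{OPT}$. 3. Fractional-MTF, with the transportation variables $f$ spelled out, is an explicit linear program in equality form with nonnegative variables and integer data, written densely with at most $D(T+1)^2(n+1)^5$ bits. Given any procedure that returns an optimal point of each linear program that has one, the algorithm (write down this linear program, call the procedure on it once, scan each $R_t$ for its first element with $A^t_{e1}\ge1/r$, move it to the front of the list, output the list) outputs a sequence as in 2, and takes at most $D(T+1)^2(n+1)^5$ elementary steps (bits of the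 linear program written, comparisons, list operations) in addition to the time of that single call. Hence it runs in polynomial time when linear programs are solved in polynomial time. -/

import Mathlib

noncomputable section

namespace MultMSSC

/-! ### Permutations, Kendall tau distance and the cost of a solution

`U` is the universe of elements. A permutation of the `n` elements of `U` is a bijection
`π : U ≃ Fin n`, where `π e` is the position of `e`; the positions `1, …, n` are numbered
`0, …, n - 1` here, so that `0` is the first position. -/

/-- Kendall tau distance: the number of (unordered) pairs that the two permutations order
differently. Each of them is counted once, as the ordered pair whose first component comes
first in `π`. -/
def kendallTau {U : Type} [Fintype U] {n : ℕ} (π σ : U ≃ Fin n) : ℕ :=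
  (Finset.univ.filter fun p : U × U => π p.1 < π p.2 ∧ σ p.2 < σ p.1).card

/-- The cost `π(R)` of covering the request `R`: the position (counted from one) of the first
element of `R` in `π`. -/
def coverCost {U : Type} {n : ℕ} (π : U ≃ Fin n) (R : Finset U) : ℕ :=
  sInf {k : ℕ | ∃ e ∈ R, k = (π e : ℕ) + 1}

/-- Covering cost plus moving cost of the sequence `π 0, π 1, …, π T`; the request of round
`t + 1` is `R t`. -/
def totalCost {U : Type} [Fintype U] {n T : ℕ} (R : Fin T → Finset U)
    (π : Fin (T + 1) → (U ≃ Fin n)) : ℕ :=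
  (∑ t : Fin T, coverCost (π t.succ) (R t)) +
    ∑ t : Fin T, kendallTau (π t.succ) (π t.castSucc)

/-- The optimal cost of Multistage Min-Sum Set Cover. -/
def optCost {U : Type} [Fintype U] {n T : ℕ} (π₀ : U ≃ Fin n) (R : Fin T → Finset U) : ℕ :=
  sInf {c : ℕ | ∃ σ : Fin (T + 1) → (U ≃ Fin n), σ 0 = π₀ ∧ c = totalCost R σ}

/-- Move `e` to the first position; the elements that were before `e` shift by one. -/
def moveToFront {U : Type} {n : ℕ} (π : U ≃ Fin n) (e : U) : U ≃ Fin n :=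
  π.trans (Fin.cycleRange (π e))

theorem moveToFront_self {U : Type} {n : ℕ} (π : U ≃ Fin n) (e : U) :
    (moveToFront π e e : ℕ) = 0 := by
  have : NeZero n := ⟨by have := (π e).isLt; omega⟩
  simp [moveToFront, Fin.cycleRange_self]

theorem moveToFront_of_lt {U : Type} {n : ℕ} (π : U ≃ Fin n) (e a : U) (h : π a < π e) :
    (moveToFront π e a : ℕ) = (π a : ℕ) + 1 := by
  simp [moveToFront, Fin.coe_cycleRange_of_lt h]

theorem moveToFront_of_gt {U : Type} {n : ℕ} (π : U ≃ Fin n) (e a : U) (h : π e < π a) :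
    moveToFront π e a = π a := by
  simp [moveToFront, Fin.cycleRange_of_gt h]

/-! ### The footrule distance and the relaxation Fractional-MTF -/

/-- The `0`-`1` matrix of a permutation (rows are elements, columns are positions). -/
def permMatrix {U : Type} {n : ℕ} (π : U ≃ Fin n) : Matrix U (Fin n) ℝ :=
  fun e i => if π e = i then 1 else 0

/-- `f` transports, for every element `e`, the row `A e` to the row `B e`. -/
structure IsTransport {U : Type} {n : ℕ} (A B : Matrix U (Fin n) ℝ)
    (f : U → Fin n → Fin n → ℝ) : Prop where
  arrive : ∀ e j, ∑ i, f e i j = B e j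
  leave : ∀ e i, ∑ j, f e i j = A e i
  nonneg : ∀ e i j, 0 ≤ f e i j

/-- The cost of a transport. -/
def transportCost {U : Type} [Fintype U] {n : ℕ} (f : U → Fin n → Fin n → ℝ) : ℝ :=
  ∑ e, ∑ i : Fin n, ∑ j : Fin n, |((i : ℕ) : ℝ) - ((j : ℕ) : ℝ)| * f e i j

/-- The footrule distance of (stochastic) matrices: the optimal value of the transportation
problem. -/
def footrule {U : Type} [Fintype U] {n : ℕ} (A B : Matrix U (Fin n) ℝ) : ℝ :=
  sInf {c : ℝ | ∃ f, IsTransport A B f ∧ c = transportCost f}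

/-- Feasible solutions `A 0, A 1, …, A T` of Fractional-MTF. -/
structure IsFeasibleMTF {U : Type} [Fintype U] {n T : ℕ} [NeZero n] (π₀ : U ≃ Fin n)
    (R : Fin T → Finset U) (A : Fin (T + 1) → Matrix U (Fin n) ℝ) : Prop where
  row : ∀ (t : Fin T) (e : U), ∑ i, A t.succ e i = 1
  col : ∀ (t : Fin T) (i : Fin n), ∑ e, A t.succ e i = 1
  request : ∀ t : Fin T, ∑ e ∈ R t, A t.succ e 0 = 1
  init : A 0 = permMatrix π₀
  nonneg : ∀ (t : Fin T) (e : U) (i : Fin n), 0 ≤ A t.succ e i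

/-- The objective of Fractional-MTF. -/
def movingCost {U : Type} [Fintype U] {n T : ℕ} (A : Fin (T + 1) → Matrix U (Fin n) ℝ) : ℝ :=
  ∑ t : Fin T, footrule (A t.succ) (A t.castSucc)

/-- Optimal solutions of Fractional-MTF. -/
def IsOptimalMTF {U : Type} [Fintype U] {n T : ℕ} [NeZero n] (π₀ : U ≃ Fin n)
    (R : Fin T → Finset U) (A : Fin (T + 1) → Matrix U (Fin n) ℝ) : Prop :=
  IsFeasibleMTF π₀ R A ∧ ∀ B, IsFeasibleMTF π₀ R B → movingCost A ≤ movingCost B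

/-- `π` is a possible output of the greedy rounding of `A`: it starts at `π₀`, and each round
moves to the front some requested element that has mass at least `1 / r` in the first
position. -/
def IsGreedyRounding {U : Type} {n T : ℕ} [NeZero n] (r : ℕ) (π₀ : U ≃ Fin n)
    (R : Fin T → Finset U) (A : Fin (T + 1) → Matrix U (Fin n) ℝ)
    (π : Fin (T + 1) → (U ≃ Fin n)) : Prop :=
  π 0 = π₀ ∧ ∀ t : Fin T, ∃ e ∈ R t, 1 / (r : ℝ) ≤ A t.succ e 0 ∧
    π t.succ = moveToFront (π t.castSucc) e

/-! ### Linear programs and Fractional-MTF written out as one -/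

/-- A linear program `min c·x` subject to `M x = b`, `x ≥ 0`, with integer data. -/
structure LinearProgram where
  Var : Type
  Con : Type
  [fintypeVar : Fintype Var]
  [fintypeCon : Fintype Con]
  mat : Con → Var → ℤ
  rhs : Con → ℤ
  obj : Var → ℤ

attribute [instance] LinearProgram.fintypeVar LinearProgram.fintypeCon

/-- Feasible points of a linear program. -/
def LinearProgram.IsFeasible (P : LinearProgram) (x : P.Var → ℝ) : Prop :=
  (∀ v, 0 ≤ x v) ∧ ∀ k, ∑ v, (P.mat k v : ℝ) * x v = P.rhs k

/-- Optimal points of a linear program. -/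
def LinearProgram.IsOptimal (P : LinearProgram) (x : P.Var → ℝ) : Prop :=
  P.IsFeasible x ∧ ∀ y, P.IsFeasible y → ∑ v, (P.obj v : ℝ) * x v ≤ ∑ v, (P.obj v : ℝ) * y v

/-- The number of bits needed to write down an integer, with a sign. -/
def intBits (z : ℤ) : ℕ := 1 + Nat.size z.natAbs

/-- The number of bits needed to write down the whole linear program. -/
def LinearProgram.bitSize (P : LinearProgram) : ℕ :=
  (∑ k, ∑ v, intBits (P.mat k v)) + (∑ k, intBits (P.rhs k)) + ∑ v, intBits (P.obj v)

/-- The variables of Fractional-MTF: the matrix entries `(t, e, i)`, and the amounts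
`(t, e, i, j)` of the transport from row `e` of `A (t + 1)` to row `e` of `A t`. -/
abbrev MTFVar (U : Type) (n T : ℕ) : Type :=
  (Fin (T + 1) × U × Fin n) ⊕ (Fin T × U × Fin n × Fin n)

/-- The equality constraints of Fractional-MTF. -/
inductive MTFCon (U : Type) (n T : ℕ) : Type
  | row (t : Fin T) (e : U)
  | col (t : Fin T) (i : Fin n)
  | request (t : Fin T)
  | init (e : U) (i : Fin n)
  | arrive (t : Fin T) (e : U) (j : Fin n)
  | leave (t : Fin T) (e : U) (i : Fin n)

/-- The constraints as a sum of products. -/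
def MTFCon.equivSum (U : Type) (n T : ℕ) :
    MTFCon U n T ≃ (Fin T × U) ⊕ (Fin T × Fin n) ⊕ Fin T ⊕ (U × Fin n) ⊕
      (Fin T × U × Fin n) ⊕ (Fin T × U × Fin n) where
  toFun
    | .row t e => .inl (t, e)
    | .col t i => .inr (.inl (t, i))
    | .request t => .inr (.inr (.inl t))
    | .init e i => .inr (.inr (.inr (.inl (e, i))))
    | .arrive t e j => .inr (.inr (.inr (.inr (.inl (t, e, j)))))
    | .leave t e i => .inr (.inr (.inr (.inr (.inr (t, e, i)))))
  invFun
    | .inl (t, e) => .row t e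
    | .inr (.inl (t, i)) => .col t i
    | .inr (.inr (.inl t)) => .request t
    | .inr (.inr (.inr (.inl (e, i)))) => .init e i
    | .inr (.inr (.inr (.inr (.inl (t, e, j))))) => .arrive t e j
    | .inr (.inr (.inr (.inr (.inr (t, e, i))))) => .leave t e i
  left_inv := by rintro (_ | _ | _ | _ | _ | _) <;> rfl
  right_inv := by rintro (_ | _ | _ | _ | _ | _) <;> rfl

instance (U : Type) [Fintype U] (n T : ℕ) : Fintype (MTFCon U n T) :=
  Fintype.ofEquiv _ (MTFCon.equivSum U n T).symm

/-- The coefficient of a variable in a constraint. -/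
def mtfMat {U : Type} [DecidableEq U] {n T : ℕ} [NeZero n] (R : Fin T → Finset U) :
    MTFCon U n T → MTFVar U n T → ℤ
  | .row t e, .inl (s, a, _) => if s = t.succ ∧ a = e then 1 else 0
  | .col t i, .inl (s, _, k) => if s = t.succ ∧ k = i then 1 else 0
  | .request t, .inl (s, a, k) => if s = t.succ ∧ a ∈ R t ∧ k = 0 then 1 else 0
  | .init e i, .inl (s, a, k) => if s = 0 ∧ a = e ∧ k = i then 1 else 0
  | .arrive t e j, .inl (s, a, k) => if s = t.castSucc ∧ a = e ∧ k = j then -1 else 0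
  | .arrive t e j, .inr (s, a, _, l) => if s = t ∧ a = e ∧ l = j then 1 else 0
  | .leave t e i, .inl (s, a, k) => if s = t.succ ∧ a = e ∧ k = i then -1 else 0
  | .leave t e i, .inr (s, a, k, _) => if s = t ∧ a = e ∧ k = i then 1 else 0
  | _, .inr _ => 0

/-- The right-hand side of a constraint. -/
def mtfRhs {U : Type} {n T : ℕ} (π₀ : U ≃ Fin n) : MTFCon U n T → ℤ
  | .row _ _ => 1
  | .col _ _ => 1
  | .request _ => 1
  | .init e i => if π₀ e = i then 1 else 0
  | .arrive _ _ _ => 0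
  | .leave _ _ _ => 0

/-- The objective: the total cost of the transports. -/
def mtfObj {U : Type} {n T : ℕ} : MTFVar U n T → ℤ
  | .inl _ => 0
  | .inr (_, _, i, j) => |((i : ℕ) : ℤ) - ((j : ℕ) : ℤ)|

/-- Fractional-MTF, with the transportation problems of the footrule distances spelled out, as
one explicit linear program. -/
def mtfLP {U : Type} [Fintype U] [DecidableEq U] {n T : ℕ} [NeZero n] (π₀ : U ≃ Fin n)
    (R : Fin T → Finset U) : LinearProgram where
  Var := MTFVar U n T
  Con := MTFCon U n T
  mat := mtfMat R
  rhs := mtfRhs π₀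
  obj := mtfObj

/-! ### The algorithm as a program that counts its steps -/

/-- A value together with the number of elementary steps spent on computing it. -/
structure Timed (α : Type) where
  val : α
  steps : ℕ

/-- Return a value, at no cost. -/
def Timed.ret {α : Type} (a : α) : Timed α := ⟨a, 0⟩

/-- Sequential composition: the numbers of steps add up. -/
def Timed.bind {α β : Type} (x : Timed α) (f : α → Timed β) : Timed β :=
  ⟨(f x.val).val, x.steps + (f x.val).steps⟩

/-- Spend `k` further steps before `x`. -/
def Timed.tick {α : Type} (k : ℕ) (x : Timed α) : Timed α := ⟨x.val, k + x.steps⟩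

/-- Scan a list for the first element of weight at least `θ`; one step per comparison. -/
def findHeavy {U : Type} (θ : ℝ) (w : U → ℝ) : List U → Timed (Option U)
  | [] => .tick 1 (.ret none)
  | e :: l => .tick 1 (if θ ≤ w e then .ret (some e) else findHeavy θ w l)

/-- Remove the first occurrence of `e` from a list; one step per visited entry. -/
def removeEntry {U : Type} [DecidableEq U] (e : U) : List U → Timed (List U)
  | [] => .tick 1 (.ret [])
  | a :: l => .tick 1 (if a = e then .ret l
      else (removeEntry e l).bind fun l' => .ret (a :: l'))

/-- One round: look in the request `L` for an element of weight at least `θ` and move it to the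
front of the list. -/
def roundStep {U : Type} [DecidableEq U] (θ : ℝ) (w : U → ℝ) (L l : List U) : Timed (List U) :=
  (findHeavy θ w L).bind fun o =>
    match o with
    | none => .ret l
    | some e => (removeEntry e l).bind fun l' => .tick 1 (.ret (e :: l'))

/-- All rounds, starting from the list `l`. A round is given by the weights of the elements and
the request. The list of every round is written to the output, one step per entry. -/
def roundAll {U : Type} [DecidableEq U] (θ : ℝ) :
    List ((U → ℝ) × List U) → List U → Timed (List (List U))
  | [], _ => .ret []
  | (w, L) :: rest, l => (roundStep θ w L l).bind fun l' =>
      .tick (1 + l'.length) ((roundAll θ rest l').bind fun out => .ret (l' :: out))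

/-- The list of the elements in the order of a permutation. -/
def listing {U : Type} {n : ℕ} (π : U ≃ Fin n) : List U := List.ofFn π.symm

/-- The procedure `solve` solves linear programs: whenever there is an optimal point, it
returns one. -/
def SolvesLP (solve : (P : LinearProgram) → Timed (P.Var → ℝ)) : Prop :=
  ∀ P : LinearProgram, (∃ x, P.IsOptimal x) → P.IsOptimal (solve P).val

/-- The greedy rounding algorithm: write down Fractional-MTF, solve it by the procedure `solve`,
and round the matrices that it returns. The request of round `t + 1` is given as the list `L t`;
the output lists the permutations of the rounds `1, …, T`. -/
def greedyAlgorithm {U : Type} [Fintype U] [DecidableEq U] {n T : ℕ} [NeZero n]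
    (solve : (P : LinearProgram) → Timed (P.Var → ℝ)) (r : ℕ) (π₀ : U ≃ Fin n)
    (L : Fin T → List U) : Timed (List (List U)) :=
  .tick (mtfLP π₀ fun t => (L t).toFinset).bitSize
    ((solve (mtfLP π₀ fun t => (L t).toFinset)).bind fun (x : MTFVar U n T → ℝ) =>
      roundAll (1 / (r : ℝ))
        (List.ofFn fun t : Fin T => ((fun e => x (.inl (t.succ, e, 0))), L t)) (listing π₀))

end MultMSSC

end

/-! The greedy rounding is analysed by a potential function. For a matrix `A` with row and column
sums one, let `q e` be the random position obtained by conditioning row `e` on the lowest `1 / r`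
of its mass (`quantileCDF`), independently for the elements `e`. No position has expected load
more than `r` under these random positions. The potential of a permutation `π` is the expected
number of pairs `a`, `b`, ordered like this by `π`, with `q b < q a` (`potential`).

* It vanishes for the matrix of `π` itself (`potential_permMatrix`), and it is nonnegative.
* If `A e 0 ≥ 1 / r`, then `q e` is the first position. So moving `e` to the front lowers the
  potential by the number of elements before `e`, up to the load `r` of the first position
  (`IsProfile.potential_moveToFront_le`).
* The potential changes by at most `2 * r` times the total `L¹` distance of the distribution
  functions of `q`, as a shift of one position meets a load of at most `r`
  (`IsProfile.potential_sub_le`). These distribution functions are `r`-Lipschitz in those of the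
  rows, whose `L¹` distance is at most the footrule distance. So changing the matrix costs at most
  `2 * r ^ 2` times the footrule distance.

Amortizing, the rounding costs at most `(1 + r) * T` plus `2 * r ^ 2` times the fractional optimum
(`IsGreedyRounding.totalCost_le`). Moreover `T` is at most the optimal cost, and the fractional
optimum is at most four times the optimal cost: in every permutation of an optimal sequence, move
the first requested element to the front, and compare the footrule with the Kendall tau distance
(`exists_isFeasibleMTF_movingCost_le`).

Optimal solutions exist because the linear program has a compact nonempty set of feasible points
(`exists_isOptimal_mtfLP`); and since the footrule distances are attained by transports, an optimal
point of the linear program restricts to an optimal solution of Fractional-MTF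
(`isOptimalMTF_of_mtfLP`). -/

noncomputable section

namespace MultMSSC

/-! ### Permutations and their costs -/

theorem moveToFront_lt_iff {U : Type} {n : ℕ} (π : U ≃ Fin n) {e a b : U} (ha : a ≠ e)
    (hb : b ≠ e) : moveToFront π e a < moveToFront π e b ↔ π a < π b := by
  have hpos : ∀ c, c ≠ e → π c < π e ∧ (moveToFront π e c : ℕ) = (π c : ℕ) + 1 ∨
      π e < π c ∧ (moveToFront π e c : ℕ) = (π c : ℕ) := by
    intro c hc
    rcases lt_or_gt_of_ne (fun h => hc (π.injective h)) with h | h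
    · exact .inl ⟨h, moveToFront_of_lt π e c h⟩
    · exact .inr ⟨h, by rw [moveToFront_of_gt π e c h]⟩
  have h1 := hpos a ha
  have h2 := hpos b hb
  simp only [Fin.lt_def] at *
  omega

theorem not_moveToFront_lt {U : Type} {n : ℕ} (π : U ≃ Fin n) (e a : U) :
    ¬ moveToFront π e a < moveToFront π e e := by
  simp [Fin.lt_def, moveToFront_self]

theorem card_filter_lt {U : Type} [Fintype U] {n : ℕ} (π : U ≃ Fin n) (e : U) :
    (Finset.univ.filter fun a => π a < π e).card = (π e : ℕ) := by
  rw [← Fin.card_Iio (π e)]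
  refine Finset.card_bij (fun a _ => π a) (by simp) (fun _ _ _ _ h => π.injective h) ?_
  intro i hi
  exact ⟨π.symm i, by simpa using hi, by simp⟩

/-- Moving `e` to the front swaps `e` with the elements before it and nothing else. -/
theorem kendallTau_moveToFront_le {U : Type} [Fintype U] {n : ℕ} (π : U ≃ Fin n) (e : U) :
    kendallTau (moveToFront π e) π ≤ (π e : ℕ) := by
  classical
  rw [← card_filter_lt π e, kendallTau]
  refine (Finset.card_le_card (t := (Finset.univ.filter fun a => π a < π e).image
    fun a => (e, a)) ?_).trans Finset.card_image_le
  rintro ⟨x, y⟩ h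
  simp only [Finset.mem_filter, Finset.mem_univ, true_and, Finset.mem_image] at h ⊢
  obtain ⟨h1, h2⟩ := h
  have hy : y ≠ e := by
    rintro rfl
    exact not_moveToFront_lt _ _ _ h1
  have hx : x = e := by
    by_contra hx
    exact lt_asymm h2 ((moveToFront_lt_iff π hx hy).1 h1)
  subst hx
  exact ⟨y, h2, rfl⟩

/-- One half of the Diaconis–Graham inequality between the footrule and the Kendall tau
distance. -/
theorem sum_abs_sub_le_kendallTau {U : Type} [Fintype U] {n : ℕ} (π σ : U ≃ Fin n) :
    ∑ e, |((π e : ℕ) : ℝ) - ((σ e : ℕ) : ℝ)| ≤ 2 * (kendallTau π σ : ℝ) := by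
  classical
  have key : ∀ (ρ τ : U ≃ Fin n) (e : U), (ρ e : ℕ) ≤ (τ e : ℕ) +
      (Finset.univ.filter fun b => ρ b < ρ e ∧ τ e < τ b).card := by
    intro ρ τ e
    rw [← card_filter_lt ρ e, ← card_filter_lt τ e]
    refine (Finset.card_le_card ?_).trans (Finset.card_union_le _ _)
    intro b hb
    simp only [Finset.mem_filter, Finset.mem_univ, true_and, Finset.mem_union] at hb ⊢
    rcases lt_trichotomy (τ b) (τ e) with h | h | h
    · exact .inl h
    · rw [τ.injective h] at hb
      exact absurd hb (lt_irrefl _)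
    · exact .inr ⟨hb, h⟩
  have hk : kendallTau π σ =
      ∑ e, (Finset.univ.filter fun b => π b < π e ∧ σ e < σ b).card := by
    rw [kendallTau, Finset.card_filter, Fintype.sum_prod_type_right]
    simp only [Finset.card_filter]
  have hk' : kendallTau π σ =
      ∑ e, (Finset.univ.filter fun b => σ b < σ e ∧ π e < π b).card := by
    rw [kendallTau, Finset.card_filter, Fintype.sum_prod_type]
    simp only [Finset.card_filter, and_comm]
  rw [two_mul]
  nth_rewrite 1 [hk]
  rw [hk']
  push_cast
  rw [← Finset.sum_add_distrib]
  refine Finset.sum_le_sum fun e _ => ?_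
  have h1 := (Nat.cast_le (α := ℝ)).2 (key π σ e)
  have h2 := (Nat.cast_le (α := ℝ)).2 (key σ π e)
  push_cast at h1 h2
  rw [abs_le]
  constructor <;> linarith [Nat.cast_nonneg (α := ℝ)
    (Finset.univ.filter fun b => π b < π e ∧ σ e < σ b).card, Nat.cast_nonneg (α := ℝ)
    (Finset.univ.filter fun b => σ b < σ e ∧ π e < π b).card]

theorem exists_mem_coverCost_eq {U : Type} {n : ℕ} (π : U ≃ Fin n) {R : Finset U}
    (hR : R.Nonempty) : ∃ e ∈ R, coverCost π R = (π e : ℕ) + 1 := by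
  obtain ⟨e, he⟩ := hR
  exact Nat.sInf_mem (s := {k : ℕ | ∃ e ∈ R, k = (π e : ℕ) + 1}) ⟨_, e, he, rfl⟩

theorem coverCost_moveToFront_le {U : Type} {n : ℕ} (π : U ≃ Fin n) {R : Finset U} {e : U}
    (he : e ∈ R) : coverCost (moveToFront π e) R ≤ 1 :=
  Nat.sInf_le ⟨e, he, by rw [moveToFront_self]⟩

theorem exists_totalCost_eq_optCost {U : Type} [Fintype U] {n T : ℕ} (π₀ : U ≃ Fin n)
    (R : Fin T → Finset U) :
    ∃ σ : Fin (T + 1) → (U ≃ Fin n), σ 0 = π₀ ∧ optCost π₀ R = totalCost R σ :=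
  Nat.sInf_mem (s := {c : ℕ | ∃ σ : Fin (T + 1) → (U ≃ Fin n), σ 0 = π₀ ∧ c = totalCost R σ})
    ⟨_, fun _ => π₀, rfl, rfl⟩

/-! ### The list algorithm -/

theorem removeEntry_val {U : Type} [DecidableEq U] (e : U) (l : List U) :
    (removeEntry e l).val = l.erase e := by
  induction l with
  | nil => rfl
  | cons a l ih =>
    by_cases h : a = e
    · subst h
      simp [removeEntry, Timed.tick, Timed.ret]
    · simp [removeEntry, Timed.tick, Timed.ret, Timed.bind, h, ih]

theorem removeEntry_steps_le {U : Type} [DecidableEq U] (e : U) (l : List U) :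
    (removeEntry e l).steps ≤ l.length + 1 := by
  induction l with
  | nil => simp [removeEntry, Timed.tick, Timed.ret]
  | cons a l ih =>
    by_cases h : a = e
    · simp [removeEntry, Timed.tick, Timed.ret, h]
    · simp only [removeEntry, Timed.tick, Timed.ret, Timed.bind, h, if_false, List.length_cons]
      omega

theorem findHeavy_val {U : Type} {θ : ℝ} {w : U → ℝ} {L : List U} (h : ∃ e ∈ L, θ ≤ w e) :
    ∃ e ∈ L, θ ≤ w e ∧ (findHeavy θ w L).val = some e := by
  induction L with
  | nil => simp at h
  | cons a L ih =>
    by_cases ha : θ ≤ w a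
    · exact ⟨a, by simp, ha, by simp [findHeavy, Timed.tick, Timed.ret, ha]⟩
    · obtain ⟨e, he, h1, h2⟩ := ih (by simpa [ha] using h)
      exact ⟨e, by simp [he], h1, by simp [findHeavy, Timed.tick, ha, h2]⟩

theorem findHeavy_steps_le {U : Type} (θ : ℝ) (w : U → ℝ) (L : List U) :
    (findHeavy θ w L).steps ≤ L.length + 1 := by
  induction L with
  | nil => simp [findHeavy, Timed.tick, Timed.ret]
  | cons a L ih =>
    by_cases ha : θ ≤ w a
    · simp [findHeavy, Timed.tick, Timed.ret, ha]
    · simp only [findHeavy, Timed.tick, ha, if_false, List.length_cons]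
      omega

theorem length_listing {U : Type} {n : ℕ} (π : U ≃ Fin n) : (listing π).length = n := by
  simp [listing]

theorem listing_moveToFront {U : Type} [DecidableEq U] {n : ℕ} (π : U ≃ Fin n) (e : U) :
    listing (moveToFront π e) = e :: (listing π).erase e := by
  have hmem : e ∈ listing π := by
    simp only [listing, List.mem_ofFn]
    exact ⟨π e, by simp⟩
  have hnd : (listing π).Nodup := List.nodup_ofFn.2 π.symm.injective
  have hlen := length_listing π
  have hidx : (listing π).idxOf e = (π e : ℕ) := by
    have h1 : (listing π)[(π e : ℕ)]'(by rw [hlen]; exact (π e).isLt) = e := by simp [listing]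
    conv_lhs => rw [← h1]
    exact hnd.idxOf_getElem _ _
  rw [List.erase_eq_eraseIdx_of_idxOf hidx]
  have hlt := (π e).isLt
  refine List.ext_getElem ?_ ?_
  · rw [List.length_cons, List.length_eraseIdx_of_lt (by omega), length_listing, hlen]
    omega
  · intro k hk _
    rw [length_listing] at hk
    simp only [listing, List.getElem_ofFn]
    rw [Equiv.symm_apply_eq]
    cases k with
    | zero =>
      simp only [List.getElem_cons_zero]
      exact Fin.ext (moveToFront_self π e).symm
    | succ k =>
      simp only [List.getElem_cons_succ, List.getElem_eraseIdx, List.getElem_ofFn]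
      split_ifs with hke
      · apply Fin.ext
        rw [moveToFront_of_lt] <;> simp [Fin.lt_def, hke]
      · rw [moveToFront_of_gt] <;> simp [Fin.lt_def]
        omega

theorem roundStep_listing {U : Type} [DecidableEq U] {n : ℕ} {θ : ℝ} {w : U → ℝ} {L : List U}
    (π : U ≃ Fin n) (h : ∃ e ∈ L, θ ≤ w e) :
    ∃ e ∈ L, θ ≤ w e ∧ (roundStep θ w L (listing π)).val = listing (moveToFront π e) ∧
      (roundStep θ w L (listing π)).steps ≤ L.length + n + 3 := by
  obtain ⟨e, he, h1, h2⟩ := findHeavy_val h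
  refine ⟨e, he, h1, ?_, ?_⟩
  · simp [roundStep, Timed.bind, Timed.tick, Timed.ret, h2, removeEntry_val,
      listing_moveToFront]
  · have := findHeavy_steps_le θ w L
    have := removeEntry_steps_le e (listing π)
    rw [length_listing] at this
    simp only [roundStep, Timed.bind, h2, Timed.tick, Timed.ret]
    omega

/-- If every round has an admissible element, the list algorithm outputs the listings of a
sequence of permutations in which each round moves an admissible element to the front. -/
theorem roundAll_listing {U : Type} [DecidableEq U] {n T m : ℕ} {θ : ℝ} (w : Fin T → U → ℝ)
    (L : Fin T → List U) (π₀ : U ≃ Fin n) (h : ∀ t, ∃ e ∈ L t, θ ≤ w t e)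
    (hm : ∀ t, (L t).length ≤ m) :
    ∃ π : Fin (T + 1) → (U ≃ Fin n), π 0 = π₀ ∧
      (∀ t : Fin T, ∃ e ∈ L t, θ ≤ w t e ∧ π t.succ = moveToFront (π t.castSucc) e) ∧
      (roundAll θ (List.ofFn fun t => (w t, L t)) (listing π₀)).val =
        List.ofFn (fun t : Fin T => listing (π t.succ)) ∧
      (roundAll θ (List.ofFn fun t => (w t, L t)) (listing π₀)).steps ≤
        T * (m + 2 * n + 4) := by
  induction T generalizing π₀ with
  | zero => exact ⟨fun _ => π₀, rfl, fun t => t.elim0, by simp [roundAll, Timed.ret],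
      by simp [roundAll, Timed.ret]⟩
  | succ T ih =>
    obtain ⟨e, he, hθ, hv, hs⟩ := roundStep_listing π₀ (h 0)
    obtain ⟨π, h0, hπ, hval, hsteps⟩ := ih (fun t => w t.succ) (fun t => L t.succ)
      (moveToFront π₀ e) (fun t => h t.succ) (fun t => hm t.succ)
    refine ⟨Fin.cons π₀ π, rfl, ?_, ?_, ?_⟩
    · intro t
      refine Fin.cases ⟨e, he, hθ, ?_⟩ (fun t => ?_) t
      · simpa using h0
      · simpa using hπ t
    · simp [List.ofFn_succ, roundAll, Timed.bind, Timed.tick, Timed.ret, hv, hval, h0]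
    · have := hm 0
      simp only [List.ofFn_succ, roundAll, Timed.bind, Timed.tick, Timed.ret, hv, length_listing]
      rw [add_one_mul]
      omega

/-! ### The footrule distance as an attained minimum -/

theorem transportCost_nonneg {U : Type} [Fintype U] {n : ℕ} {A B : Matrix U (Fin n) ℝ}
    {f : U → Fin n → Fin n → ℝ} (hf : IsTransport A B f) : 0 ≤ transportCost f :=
  Finset.sum_nonneg fun _ _ => Finset.sum_nonneg fun _ _ => Finset.sum_nonneg fun _ _ =>
    mul_nonneg (abs_nonneg _) (hf.nonneg _ _ _)

theorem footrule_le_transportCost {U : Type} [Fintype U] {n : ℕ} {A B : Matrix U (Fin n) ℝ}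
    {f : U → Fin n → Fin n → ℝ} (hf : IsTransport A B f) : footrule A B ≤ transportCost f :=
  csInf_le ⟨0, by rintro _ ⟨g, hg, rfl⟩; exact transportCost_nonneg hg⟩ ⟨f, hf, rfl⟩

/-- The independent coupling of the rows of two row-stochastic matrices. -/
theorem isTransport_mul {U : Type} {n : ℕ} {A B : Matrix U (Fin n) ℝ}
    (hA : ∀ e i, 0 ≤ A e i) (hB : ∀ e i, 0 ≤ B e i) (hA1 : ∀ e, ∑ i, A e i = 1)
    (hB1 : ∀ e, ∑ i, B e i = 1) : IsTransport A B fun e i j => A e i * B e j where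
  arrive e j := by rw [← Finset.sum_mul, hA1, one_mul]
  leave e i := by rw [← Finset.mul_sum, hB1, mul_one]
  nonneg e i j := mul_nonneg (hA e i) (hB e j)

theorem continuous_transportCost {U : Type} [Fintype U] {n : ℕ} :
    Continuous (transportCost : (U → Fin n → Fin n → ℝ) → ℝ) := by
  unfold transportCost
  fun_prop

theorem exists_transportCost_eq_footrule {U : Type} [Fintype U] {n : ℕ}
    {A B : Matrix U (Fin n) ℝ} (hA : ∀ e i, 0 ≤ A e i) (hB : ∀ e i, 0 ≤ B e i)
    (hA1 : ∀ e, ∑ i, A e i = 1) (hB1 : ∀ e, ∑ i, B e i = 1) :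
    ∃ f, IsTransport A B f ∧ footrule A B = transportCost f := by
  have hcl : IsClosed {f : U → Fin n → Fin n → ℝ | IsTransport A B f} := by
    have : {f : U → Fin n → Fin n → ℝ | IsTransport A B f} =
        {f | (∀ e j, ∑ i, f e i j = B e j) ∧ (∀ e i, ∑ j, f e i j = A e i) ∧
          ∀ e i j, 0 ≤ f e i j} :=
      Set.ext fun f => ⟨fun h => ⟨h.arrive, h.leave, h.nonneg⟩, fun h => ⟨h.1, h.2.1, h.2.2⟩⟩
    rw [this]
    simp only [Set.ofPred_and, Set.ofPred_forall]
    refine IsClosed.inter ?_ (IsClosed.inter ?_ ?_)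
    · exact isClosed_iInter fun e => isClosed_iInter fun j =>
        isClosed_eq (by fun_prop) continuous_const
    · exact isClosed_iInter fun e => isClosed_iInter fun j =>
        isClosed_eq (by fun_prop) continuous_const
    · exact isClosed_iInter fun e => isClosed_iInter fun i => isClosed_iInter fun j =>
        isClosed_le continuous_const (by fun_prop)
  have hcpt : IsCompact {f : U → Fin n → Fin n → ℝ | IsTransport A B f} := by
    refine IsCompact.of_isClosed_subset
      (isCompact_Icc (a := fun _ _ _ => (0 : ℝ)) (b := fun e i _ => A e i)) hcl ?_
    intro f hf
    refine ⟨fun e i j => hf.nonneg e i j, fun e i j => ?_⟩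
    change f e i j ≤ A e i
    rw [← hf.leave e i]
    exact Finset.single_le_sum (f := fun j => f e i j) (fun j _ => hf.nonneg e i j)
      (Finset.mem_univ j)
  obtain ⟨f, hf, hmin⟩ := hcpt.exists_isMinOn ⟨_, isTransport_mul hA hB hA1 hB1⟩
    continuous_transportCost.continuousOn
  refine ⟨f, hf, le_antisymm (footrule_le_transportCost hf) ?_⟩
  refine le_csInf ⟨_, f, hf, rfl⟩ ?_
  rintro _ ⟨g, hg, rfl⟩
  exact hmin hg

/-! ### Permutation matrices as feasible solutions -/

theorem sum_permMatrix_row {U : Type} {n : ℕ} (π : U ≃ Fin n) (e : U) :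
    ∑ i, permMatrix π e i = 1 := by
  simp [permMatrix]

theorem sum_permMatrix_col {U : Type} [Fintype U] {n : ℕ} (π : U ≃ Fin n) (i : Fin n) :
    ∑ e, permMatrix π e i = 1 := by
  classical
  simp [permMatrix, ← Equiv.eq_symm_apply]

theorem permMatrix_nonneg {U : Type} {n : ℕ} (π : U ≃ Fin n) (e : U) (i : Fin n) :
    0 ≤ permMatrix π e i := by
  unfold permMatrix
  split_ifs <;> norm_num

theorem footrule_permMatrix_le {U : Type} [Fintype U] {n : ℕ} (π σ : U ≃ Fin n) :
    footrule (permMatrix π) (permMatrix σ) ≤ ∑ e, |((π e : ℕ) : ℝ) - ((σ e : ℕ) : ℝ)| := by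
  refine (footrule_le_transportCost (isTransport_mul (permMatrix_nonneg π)
    (permMatrix_nonneg σ) (sum_permMatrix_row π) (sum_permMatrix_row σ))).trans (le_of_eq ?_)
  simp [transportCost, permMatrix]

theorem isFeasibleMTF_permMatrix {U : Type} [Fintype U] {n T : ℕ} [NeZero n] {π₀ : U ≃ Fin n}
    {R : Fin T → Finset U} {τ : Fin (T + 1) → (U ≃ Fin n)} (h0 : τ 0 = π₀)
    (h : ∀ t : Fin T, ∃ e ∈ R t, (τ t.succ e : ℕ) = 0) :
    IsFeasibleMTF π₀ R fun t => permMatrix (τ t) where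
  row _ := sum_permMatrix_row _
  col _ := sum_permMatrix_col _
  init := by rw [h0]
  nonneg _ := permMatrix_nonneg _
  request t := by
    classical
    obtain ⟨e, he, h⟩ := h t
    have h' : τ t.succ e = 0 := Fin.ext h
    have : ∀ a, τ t.succ a = 0 ↔ a = e := fun a => by
      rw [← h', (τ t.succ).injective.eq_iff]
    simp [permMatrix, this, he]

namespace IsFeasibleMTF

variable {U : Type} [Fintype U] {n T : ℕ} [NeZero n] {π₀ : U ≃ Fin n} {R : Fin T → Finset U}
  {A : Fin (T + 1) → Matrix U (Fin n) ℝ}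

theorem entry_nonneg (h : IsFeasibleMTF π₀ R A) (t : Fin (T + 1)) (e : U) (i : Fin n) :
    0 ≤ A t e i := by
  refine Fin.cases ?_ (fun t => h.nonneg t e i) t
  rw [h.init]
  exact permMatrix_nonneg _ _ _

theorem sum_row (h : IsFeasibleMTF π₀ R A) (t : Fin (T + 1)) (e : U) : ∑ i, A t e i = 1 := by
  refine Fin.cases ?_ (fun t => h.row t e) t
  rw [h.init]
  exact sum_permMatrix_row _ _

theorem sum_col (h : IsFeasibleMTF π₀ R A) (t : Fin (T + 1)) (i : Fin n) :
    ∑ e, A t e i = 1 := by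
  refine Fin.cases ?_ (fun t => h.col t i) t
  rw [h.init]
  exact sum_permMatrix_col _ _

theorem entry_le_one (h : IsFeasibleMTF π₀ R A) (t : Fin (T + 1)) (e : U) (i : Fin n) :
    A t e i ≤ 1 := by
  rw [← h.sum_row t e]
  exact Finset.single_le_sum (f := fun i => A t e i) (fun i _ => h.entry_nonneg t e i)
    (Finset.mem_univ i)

/-- Some requested element has at least the average mass in the first position. -/
theorem exists_heavy (h : IsFeasibleMTF π₀ R A) {r : ℕ} (t : Fin T) (hR : (R t).Nonempty)
    (hr : (R t).card ≤ r) : ∃ e ∈ R t, 1 / (r : ℝ) ≤ A t.succ e 0 := by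
  by_contra! hlt
  have hpos : (0 : ℝ) < r := mod_cast hR.card_pos.trans_le hr
  have h1 : ∑ e ∈ R t, A t.succ e 0 < ∑ _e ∈ R t, 1 / (r : ℝ) :=
    Finset.sum_lt_sum_of_nonempty hR hlt
  rw [h.request t, Finset.sum_const, nsmul_eq_mul, mul_one_div, one_lt_div hpos] at h1
  exact absurd (Nat.cast_lt.1 h1) (not_lt.2 hr)

theorem exists_optimal_transports (h : IsFeasibleMTF π₀ R A) :
    ∃ f : Fin T → U → Fin n → Fin n → ℝ,
      (∀ t, IsTransport (A t.succ) (A t.castSucc) (f t)) ∧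
        movingCost A = ∑ t, transportCost (f t) := by
  choose f hf hc using fun t : Fin T => exists_transportCost_eq_footrule
    (h.entry_nonneg t.succ) (h.entry_nonneg t.castSucc) (h.sum_row t.succ) (h.sum_row t.castSucc)
  exact ⟨f, hf, Finset.sum_congr rfl fun t _ => hc t⟩

end IsFeasibleMTF

/-! ### The linear program -/

theorem LinearProgram.exists_isOptimal_of_le_one (P : LinearProgram) (hP : ∃ x, P.IsFeasible x)
    (h1 : ∀ x, P.IsFeasible x → ∀ v, x v ≤ 1) : ∃ x, P.IsOptimal x := by
  have hcl : IsClosed {x | P.IsFeasible x} := by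
    simp only [LinearProgram.IsFeasible, Set.ofPred_and, Set.ofPred_forall]
    refine IsClosed.inter (isClosed_iInter fun v => isClosed_le continuous_const (by fun_prop))
      (isClosed_iInter fun k => isClosed_eq (by fun_prop) continuous_const)
  have hcpt : IsCompact {x | P.IsFeasible x} := by
    refine IsCompact.of_isClosed_subset (isCompact_Icc (a := fun _ => (0 : ℝ)) (b := fun _ => 1))
      hcl ?_
    exact fun x hx => ⟨hx.1, h1 x hx⟩
  obtain ⟨x, hx, hmin⟩ := hcpt.exists_isMinOn (f := fun x => ∑ v, (P.obj v : ℝ) * x v) hP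
    (by fun_prop)
  exact ⟨x, hx, fun y hy => hmin hy⟩

theorem mtfLP_objective {U : Type} [Fintype U] {n T : ℕ} (x : MTFVar U n T → ℝ) :
    ∑ v : MTFVar U n T, (mtfObj v : ℝ) * x v =
      ∑ t, transportCost fun e i j => x (.inr (t, e, i, j)) := by
  simp [mtfObj, transportCost, Fintype.sum_sum_type, Fintype.sum_prod_type]

theorem intBits_le (z : ℤ) {m : ℕ} (h : z.natAbs ≤ m) : intBits z ≤ m + 1 := by
  rw [intBits, add_comm]
  exact Nat.succ_le_succ ((Nat.size_le.2 Nat.lt_two_pow_self).trans h)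

theorem natAbs_mtfMat_le {U : Type} [DecidableEq U] {n T : ℕ} [NeZero n]
    {R : Fin T → Finset U} (k : MTFCon U n T) (v : MTFVar U n T) :
    (mtfMat R k v).natAbs ≤ 1 := by
  rcases k with _ | _ | _ | _ | _ | _ <;> rcases v with _ | _ <;> simp only [mtfMat] <;>
    (try split_ifs) <;> simp

theorem card_MTFCon_le {U : Type} [Fintype U] {n T : ℕ} (π₀ : U ≃ Fin n) :
    Fintype.card (MTFCon U n T) ≤ 6 * (T + 1) * (n + 1) ^ 2 := by
  have hU : Fintype.card U = n := by simpa using Fintype.card_congr π₀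
  rw [Fintype.card_congr (MTFCon.equivSum U n T)]
  simp only [Fintype.card_sum, Fintype.card_prod, Fintype.card_fin, hU]
  nlinarith [Nat.zero_le (T * n), Nat.zero_le (T * (n * n))]

theorem card_MTFVar_le {U : Type} [Fintype U] {n T : ℕ} (π₀ : U ≃ Fin n) :
    Fintype.card (MTFVar U n T) ≤ 2 * (T + 1) * (n + 1) ^ 3 := by
  have hU : Fintype.card U = n := by simpa using Fintype.card_congr π₀
  simp only [Fintype.card_sum, Fintype.card_prod, Fintype.card_fin, hU]
  have h1 : n * n ≤ (n + 1) ^ 3 := by nlinarith [Nat.zero_le (n ^ 3)]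
  have h2 : n * (n * n) ≤ (n + 1) ^ 3 := by nlinarith
  have h3 := Nat.mul_le_mul_left (T + 1) h1
  have h4 := Nat.mul_le_mul_left T h2
  nlinarith [Nat.zero_le ((n + 1) ^ 3)]

section LP

variable {U : Type} [Fintype U] [DecidableEq U] {n T : ℕ} [NeZero n] {π₀ : U ≃ Fin n}
  {R : Fin T → Finset U}

theorem mtfLP_isFeasible_iff {x : MTFVar U n T → ℝ} :
    (mtfLP π₀ R).IsFeasible x ↔
      (∀ v, 0 ≤ x v) ∧ IsFeasibleMTF π₀ R (fun t e i => x (.inl (t, e, i))) ∧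
        ∀ t : Fin T, IsTransport (fun e i => x (.inl (t.succ, e, i)))
          (fun e i => x (.inl (t.castSucc, e, i))) fun e i j => x (.inr (t, e, i, j)) := by
  have hrow : ∀ t e, ∑ v : MTFVar U n T, (mtfMat R (.row t e) v : ℝ) * x v =
      ∑ i, x (.inl (t.succ, e, i)) := by
    intro t e
    simp [mtfMat, Fintype.sum_sum_type, Fintype.sum_prod_type, ite_and]
    rw [Finset.sum_comm]
    simp
  have hcol : ∀ t i, ∑ v : MTFVar U n T, (mtfMat R (.col t i) v : ℝ) * x v =
      ∑ e, x (.inl (t.succ, e, i)) := by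
    intro t e
    simp [mtfMat, Fintype.sum_sum_type, Fintype.sum_prod_type, ite_and]
  have hreq : ∀ t, ∑ v : MTFVar U n T, (mtfMat R (.request t) v : ℝ) * x v =
      ∑ e ∈ R t, x (.inl (t.succ, e, 0)) := by
    intro t
    simp [mtfMat, Fintype.sum_sum_type, Fintype.sum_prod_type, ite_and]
  have hinit : ∀ e i, ∑ v : MTFVar U n T, (mtfMat R (.init e i) v : ℝ) * x v =
      x (.inl (0, e, i)) := by
    intro e i
    simp [mtfMat, Fintype.sum_sum_type, Fintype.sum_prod_type, ite_and]
  have harr : ∀ t e j, ∑ v : MTFVar U n T, (mtfMat R (.arrive t e j) v : ℝ) * x v =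
      ∑ i, x (.inr (t, e, i, j)) - x (.inl (t.castSucc, e, j)) := by
    intro t e j
    simp [mtfMat, Fintype.sum_sum_type, Fintype.sum_prod_type, ite_and]
    ring
  have hlea : ∀ t e i, ∑ v : MTFVar U n T, (mtfMat R (.leave t e i) v : ℝ) * x v =
      ∑ j, x (.inr (t, e, i, j)) - x (.inl (t.succ, e, i)) := by
    intro t e i
    simp [mtfMat, Fintype.sum_sum_type, Fintype.sum_prod_type, ite_and]
    rw [Finset.sum_comm]
    simp only [Finset.sum_ite_eq', Finset.mem_univ, if_true]
    ring
  constructor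
  · rintro ⟨h0, h⟩
    have h : ∀ k : MTFCon U n T,
      ∑ v : MTFVar U n T, (mtfMat R k v : ℝ) * x v = (mtfRhs π₀ k : ℤ) := h
    refine ⟨h0, ⟨fun t e => ?_, fun t i => ?_, fun t => ?_, ?_, fun t e i => h0 _⟩,
      fun t => ⟨fun e j => ?_, fun e i => ?_, fun e i j => h0 _⟩⟩
    · simpa [hrow, mtfRhs] using h (.row t e)
    · simpa [hcol, mtfRhs] using h (.col t i)
    · simpa [hreq, mtfRhs] using h (.request t)
    · ext e i
      simpa [hinit, mtfRhs, permMatrix] using h (.init e i)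
    · simpa [harr, mtfRhs, sub_eq_zero] using h (.arrive t e j)
    · simpa [hlea, mtfRhs, sub_eq_zero] using h (.leave t e i)
  · rintro ⟨h0, hA, hf⟩
    refine ⟨h0, ?_⟩
    suffices h : ∀ k : MTFCon U n T,
      ∑ v : MTFVar U n T, (mtfMat R k v : ℝ) * x v = (mtfRhs π₀ k : ℤ) from h
    rintro (⟨t, e⟩ | ⟨t, i⟩ | t | ⟨e, i⟩ | ⟨t, e, j⟩ | ⟨t, e, i⟩)
    · simpa [hrow, mtfRhs] using hA.row t e
    · simpa [hcol, mtfRhs] using hA.col t i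
    · simpa [hreq, mtfRhs] using hA.request t
    · simpa [hinit, mtfRhs, permMatrix] using congrFun (congrFun hA.init e) i
    · simpa [harr, mtfRhs, sub_eq_zero] using (hf t).arrive e j
    · simpa [hlea, mtfRhs, sub_eq_zero] using (hf t).leave e i

/-- A feasible solution of Fractional-MTF together with optimal transports is a feasible point of
the linear program with the same objective value. -/
theorem exists_mtfLP_point {A : Fin (T + 1) → Matrix U (Fin n) ℝ} (hA : IsFeasibleMTF π₀ R A) :
    ∃ x : MTFVar U n T → ℝ, (mtfLP π₀ R).IsFeasible x ∧
      ∑ v : MTFVar U n T, (mtfObj v : ℝ) * x v = movingCost A := by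
  obtain ⟨f, hf, hc⟩ := hA.exists_optimal_transports
  refine ⟨Sum.elim (fun p => A p.1 p.2.1 p.2.2) fun p => f p.1 p.2.1 p.2.2.1 p.2.2.2,
    mtfLP_isFeasible_iff.2 ⟨?_, hA, hf⟩, ?_⟩
  · rintro (⟨t, e, i⟩ | ⟨t, e, i, j⟩)
    · exact hA.entry_nonneg t e i
    · exact (hf t).nonneg e i j
  · rw [mtfLP_objective, hc]
    rfl

theorem isOptimalMTF_of_mtfLP {x : MTFVar U n T → ℝ} (hx : (mtfLP π₀ R).IsOptimal x) :
    IsOptimalMTF π₀ R fun t e i => x (.inl (t, e, i)) := by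
  obtain ⟨-, hA, hf⟩ := mtfLP_isFeasible_iff.1 hx.1
  refine ⟨hA, fun B hB => ?_⟩
  obtain ⟨y, hy, hc⟩ := exists_mtfLP_point hB
  have hle : ∑ v : MTFVar U n T, (mtfObj v : ℝ) * x v ≤
    ∑ v : MTFVar U n T, (mtfObj v : ℝ) * y v := hx.2 y hy
  rw [hc, mtfLP_objective] at hle
  exact (Finset.sum_le_sum fun t _ => footrule_le_transportCost (hf t)).trans hle

theorem exists_isOptimal_mtfLP (hR : ∀ t, (R t).Nonempty) : ∃ x, (mtfLP π₀ R).IsOptimal x := by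
  refine LinearProgram.exists_isOptimal_of_le_one _ ?_ ?_
  · choose e he using hR
    let τ : Fin (T + 1) → (U ≃ Fin n) := Fin.cases π₀ fun t => moveToFront π₀ (e t)
    have hτ : IsFeasibleMTF π₀ R fun t => permMatrix (τ t) :=
      isFeasibleMTF_permMatrix rfl fun t => ⟨e t, he t, moveToFront_self π₀ (e t)⟩
    obtain ⟨x, hx, -⟩ := exists_mtfLP_point hτ
    exact ⟨x, hx⟩
  · intro x hx
    obtain ⟨h0, hA, hf⟩ := mtfLP_isFeasible_iff.1 hx
    rintro (⟨t, e, i⟩ | ⟨t, e, i, j⟩)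
    · exact hA.entry_le_one t e i
    · refine le_trans ?_ (hA.entry_le_one t.succ e i)
      rw [← (hf t).leave e i]
      exact Finset.single_le_sum (f := fun j => x (.inr (t, e, i, j))) (fun j _ => h0 _)
        (Finset.mem_univ j)

theorem bitSize_mtfLP_le (π₀ : U ≃ Fin n) (R : Fin T → Finset U) :
    (mtfLP π₀ R).bitSize ≤ 38 * (T + 1) ^ 2 * (n + 1) ^ 5 := by
  have hM : ∑ k : MTFCon U n T, ∑ v : MTFVar U n T, intBits (mtfMat R k v) ≤
      Fintype.card (MTFCon U n T) * (Fintype.card (MTFVar U n T) * 2) := by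
    simpa using Finset.sum_le_card_nsmul (Finset.univ : Finset (MTFCon U n T)) _ _ fun k _ =>
      Finset.sum_le_card_nsmul (Finset.univ : Finset (MTFVar U n T)) _ 2 fun v _ =>
        intBits_le _ (natAbs_mtfMat_le (R := R) k v)
  have hb : ∑ k : MTFCon U n T, intBits (mtfRhs π₀ k) ≤ Fintype.card (MTFCon U n T) * 2 := by
    refine (Finset.sum_le_card_nsmul (Finset.univ : Finset (MTFCon U n T)) _ 2 fun k _ =>
      intBits_le _ ?_).trans (by simp)
    rcases k with _ | _ | _ | _ | _ | _ <;> simp only [mtfRhs] <;> (try split_ifs) <;> simp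
  have ho : ∑ v : MTFVar U n T, intBits (mtfObj v) ≤
      Fintype.card (MTFVar U n T) * (n + 1) := by
    refine (Finset.sum_le_card_nsmul (Finset.univ : Finset (MTFVar U n T)) _ (n + 1) fun v _ =>
      intBits_le _ ?_).trans (by simp)
    rcases v with _ | ⟨t, e, i, j⟩
    · simp [mtfObj]
    · have := i.isLt
      have := j.isLt
      simp only [mtfObj, Int.natAbs_abs]
      omega
  have hC := card_MTFCon_le (T := T) π₀
  have hV := card_MTFVar_le (T := T) π₀
  have hT : T + 1 ≤ (T + 1) ^ 2 := Nat.le_self_pow two_ne_zero _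
  have hn2 : (n + 1) ^ 2 ≤ (n + 1) ^ 5 := Nat.pow_le_pow_right (by omega) (by omega)
  have hn4 : (n + 1) ^ 4 ≤ (n + 1) ^ 5 := Nat.pow_le_pow_right (by omega) (by omega)
  calc (mtfLP π₀ R).bitSize
      ≤ Fintype.card (MTFCon U n T) * (Fintype.card (MTFVar U n T) * 2) +
          Fintype.card (MTFCon U n T) * 2 + Fintype.card (MTFVar U n T) * (n + 1) :=
        add_le_add (add_le_add hM hb) ho
    _ ≤ (6 * (T + 1) * (n + 1) ^ 2) * ((2 * (T + 1) * (n + 1) ^ 3) * 2) +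
          (6 * (T + 1) * (n + 1) ^ 2) * 2 + (2 * (T + 1) * (n + 1) ^ 3) * (n + 1) := by
        gcongr
    _ = 24 * ((T + 1) ^ 2 * (n + 1) ^ 5) + 12 * ((T + 1) * (n + 1) ^ 2) +
          2 * ((T + 1) * (n + 1) ^ 4) := by ring
    _ ≤ 24 * ((T + 1) ^ 2 * (n + 1) ^ 5) + 12 * ((T + 1) ^ 2 * (n + 1) ^ 5) +
          2 * ((T + 1) ^ 2 * (n + 1) ^ 5) := by gcongr
    _ = 38 * (T + 1) ^ 2 * (n + 1) ^ 5 := by ring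

end LP

/-! ### The potential function -/

/-- If `F` and `G` are the distribution functions (`F k` is the mass of the positions `< k`) of
two independent random positions, the probability that the first position is smaller. -/
def precProb (n : ℕ) (F G : ℕ → ℝ) : ℝ :=
  ∑ j ∈ Finset.range n, F j * (G (j + 1) - G j)

/-- Distribution functions `F e` of random positions, one for each element, such that no position
carries total mass more than `r`. -/
structure IsProfile {U : Type} [Fintype U] (n : ℕ) (r : ℝ) (F : U → ℕ → ℝ) : Prop where
  zero : ∀ e, F e 0 = 0
  one : ∀ e, F e n = 1
  mono : ∀ e, Monotone (F e)
  le_one : ∀ e k, F e k ≤ 1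
  load : ∀ j < n, ∑ e, (F e (j + 1) - F e j) ≤ r

/-- The expected number of pairs of elements whose order in `π` is strictly reversed by
independent random positions with the distribution functions `F`. -/
def potential {U : Type} [Fintype U] {n : ℕ} (π : U ≃ Fin n) (F : U → ℕ → ℝ) : ℝ :=
  ∑ a, ∑ b, if π a < π b then precProb n (F b) (F a) else 0

section Potential

variable {U : Type} [Fintype U] {n : ℕ} {r : ℝ} {F F' : U → ℕ → ℝ}

/-- Summation by parts, to bound the dependence on the second argument. -/
theorem precProb_eq_sub (F G : ℕ → ℝ) :
    precProb n F G = F n * G n - F 0 * G 0 -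
      ∑ j ∈ Finset.range n, G (j + 1) * (F (j + 1) - F j) := by
  rw [eq_sub_iff_add_eq, precProb, ← Finset.sum_add_distrib,
    ← Finset.sum_range_sub (fun j => F j * G j)]
  exact Finset.sum_congr rfl fun j _ => by ring

namespace IsProfile

theorem nonneg (hF : IsProfile n r F) (e : U) (k : ℕ) : 0 ≤ F e k := by
  rw [← hF.zero e]
  exact hF.mono e (Nat.zero_le k)

theorem sub_nonneg (hF : IsProfile n r F) (e : U) (j : ℕ) : 0 ≤ F e (j + 1) - F e j :=
  _root_.sub_nonneg.2 (hF.mono e (Nat.le_succ j))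

theorem precProb_nonneg (hF : IsProfile n r F) (a b : U) : 0 ≤ precProb n (F b) (F a) :=
  Finset.sum_nonneg fun _ _ => mul_nonneg (hF.nonneg _ _) (hF.sub_nonneg _ _)

theorem potential_nonneg (hF : IsProfile n r F) (π : U ≃ Fin n) : 0 ≤ potential π F :=
  Finset.sum_nonneg fun _ _ => Finset.sum_nonneg fun _ _ => by
    split_ifs
    · exact hF.precProb_nonneg _ _
    · exact le_rfl

theorem precProb_sub_le (hF : IsProfile n r F) (hF' : IsProfile n r F') (a b : U) :
    precProb n (F' b) (F' a) - precProb n (F b) (F a) ≤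
      ∑ j ∈ Finset.range n, |F' b j - F b j| * (F' a (j + 1) - F' a j) +
        ∑ j ∈ Finset.range n, |F' a (j + 1) - F a (j + 1)| * (F b (j + 1) - F b j) := by
  have h1 : precProb n (F' b) (F' a) - precProb n (F b) (F' a) ≤
      ∑ j ∈ Finset.range n, |F' b j - F b j| * (F' a (j + 1) - F' a j) := by
    simp only [precProb]
    rw [← Finset.sum_sub_distrib]
    refine Finset.sum_le_sum fun j _ => ?_
    rw [← sub_mul]
    exact mul_le_mul_of_nonneg_right (le_abs_self _) (hF'.sub_nonneg a j)
  have h2 : precProb n (F b) (F' a) - precProb n (F b) (F a) ≤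
      ∑ j ∈ Finset.range n, |F' a (j + 1) - F a (j + 1)| * (F b (j + 1) - F b j) := by
    rw [precProb_eq_sub, precProb_eq_sub, hF.one, hF'.one, hF.one, hF.zero, hF'.zero,
      hF.zero, sub_sub_sub_cancel_left, ← Finset.sum_sub_distrib]
    refine Finset.sum_le_sum fun j _ => ?_
    rw [← sub_mul, abs_sub_comm]
    exact mul_le_mul_of_nonneg_right (le_abs_self _) (hF.sub_nonneg b j)
  linarith

/-- The potential is Lipschitz in the profile: displacing mass of one element by one position
affects its order with a load of at most `r`. -/
theorem potential_sub_le (hF : IsProfile n r F) (hF' : IsProfile n r F') (π : U ≃ Fin n) :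
    potential π F' - potential π F ≤
      2 * r * ∑ e, ∑ k ∈ Finset.range (n + 1), |F' e k - F e k| := by
  have h1 : potential π F' - potential π F ≤
      ∑ a, ∑ b, (∑ j ∈ Finset.range n, |F' b j - F b j| * (F' a (j + 1) - F' a j) +
        ∑ j ∈ Finset.range n, |F' a (j + 1) - F a (j + 1)| * (F b (j + 1) - F b j)) := by
    rw [potential, potential, ← Finset.sum_sub_distrib]
    refine Finset.sum_le_sum fun a _ => ?_
    rw [← Finset.sum_sub_distrib]
    refine Finset.sum_le_sum fun b _ => ?_
    split_ifs
    · exact hF.precProb_sub_le hF' a b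
    · rw [sub_zero]
      exact add_nonneg
        (Finset.sum_nonneg fun j _ => mul_nonneg (abs_nonneg _) (hF'.sub_nonneg a j))
        (Finset.sum_nonneg fun j _ => mul_nonneg (abs_nonneg _) (hF.sub_nonneg b j))
  refine h1.trans ?_
  have h2 : ∀ b, ∑ a, ∑ j ∈ Finset.range n, |F' b j - F b j| * (F' a (j + 1) - F' a j) ≤
      r * ∑ k ∈ Finset.range (n + 1), |F' b k - F b k| := by
    intro b
    have hr : 0 ≤ r * |F' b n - F b n| := by simp [hF.one, hF'.one]
    rw [Finset.sum_comm, Finset.sum_range_succ, mul_add, Finset.mul_sum]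
    refine le_add_of_le_of_nonneg (Finset.sum_le_sum fun j hj => ?_) hr
    rw [← Finset.mul_sum, mul_comm r]
    exact mul_le_mul_of_nonneg_left (hF'.load j (Finset.mem_range.1 hj)) (abs_nonneg _)
  have h3 : ∀ a, ∑ b, ∑ j ∈ Finset.range n,
      |F' a (j + 1) - F a (j + 1)| * (F b (j + 1) - F b j) ≤
      r * ∑ k ∈ Finset.range (n + 1), |F' a k - F a k| := by
    intro a
    rw [Finset.sum_comm, Finset.sum_range_succ', mul_add, Finset.mul_sum]
    refine le_add_of_le_of_nonneg (Finset.sum_le_sum fun j hj => ?_)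
      (by simp [hF.zero, hF'.zero])
    rw [← Finset.mul_sum, mul_comm r]
    exact mul_le_mul_of_nonneg_left (hF.load j (Finset.mem_range.1 hj)) (abs_nonneg _)
  simp only [Finset.sum_add_distrib]
  rw [Finset.sum_comm, mul_assoc, two_mul, Finset.mul_sum]
  exact add_le_add (Finset.sum_le_sum fun b _ => h2 b) (Finset.sum_le_sum fun a _ => h3 a)

/-- If the position of `e` is the first one almost surely, moving `e` to the front pays for the
elements that were before `e`, up to the load of the first position. -/
theorem potential_moveToFront_le [NeZero n] (hF : IsProfile n r F) (π : U ≃ Fin n) {e : U}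
    (he : F e 1 = 1) : potential (moveToFront π e) F ≤ potential π F - (π e : ℕ) + r := by
  classical
  obtain ⟨m, rfl⟩ : ∃ m, n = m + 1 := Nat.exists_eq_succ_of_ne_zero (NeZero.ne n)
  -- hence `e` precedes exactly the elements whose random position is not the first one
  have he1 : ∀ j, F e (j + 1) = 1 := fun j =>
    le_antisymm (hF.le_one e _) (he.symm.le.trans (hF.mono e (by omega)))
  have hbe : ∀ b, precProb (m + 1) (F b) (F e) = 0 := by
    intro b
    rw [precProb, Finset.sum_range_succ']
    simp [he1, hF.zero]
  have hea : ∀ a, precProb (m + 1) (F e) (F a) = 1 - F a 1 := by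
    intro a
    rw [precProb, Finset.sum_range_succ', hF.zero e, zero_mul, add_zero, ← hF.one a,
      ← Finset.sum_range_sub (fun j => F a (j + 1))]
    exact Finset.sum_congr rfl fun j _ => by rw [he1, one_mul]
  -- only the pairs of `e` with an element `a` before it change their order, from cost
  -- `1 - F a 1` to cost `0`
  have hpair : ∀ a b,
      (if moveToFront π e a < moveToFront π e b then precProb (m + 1) (F b) (F a) else 0) ≤
      (if π a < π b then precProb (m + 1) (F b) (F a) else 0) -
        if b = e then (if π a < π e then 1 - F a 1 else 0) else 0 := by
    intro a b
    by_cases hb : b = e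
    · subst hb
      rw [if_neg (not_moveToFront_lt π _ a), if_pos rfl, hea, sub_self]
    · rw [if_neg hb, sub_zero]
      by_cases ha : a = e
      · subst ha
        simp [hbe]
      · simp only [moveToFront_lt_iff π ha hb, le_refl]
  have hsum : potential (moveToFront π e) F ≤ potential π F -
      ∑ a, if π a < π e then 1 - F a 1 else 0 := by
    rw [potential, potential, ← Finset.sum_sub_distrib]
    refine Finset.sum_le_sum fun a _ => ?_
    refine (Finset.sum_le_sum fun b _ => hpair a b).trans (le_of_eq ?_)
    rw [Finset.sum_sub_distrib, Finset.sum_ite_eq' Finset.univ e]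
    simp
  have hfirst : ∑ a, F a 1 ≤ r := by
    simpa [hF.zero] using hF.load 0 (Nat.succ_pos m)
  have hcount : ((π e : ℕ) : ℝ) - r ≤ ∑ a, if π a < π e then 1 - F a 1 else 0 := by
    have hcard : ((π e : ℕ) : ℝ) = ∑ a, if π a < π e then (1 : ℝ) else 0 := by
      rw [← card_filter_lt π e, Finset.card_filter]
      push_cast
      rfl
    rw [sub_le_iff_le_add, hcard]
    refine le_trans ?_ (add_le_add_right hfirst _)
    rw [← Finset.sum_add_distrib]
    refine Finset.sum_le_sum fun a _ => ?_
    split_ifs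
    · linarith
    · linarith [hF.nonneg a 1]
  linarith

end IsProfile

end Potential

/-! ### The lower quantiles of a doubly stochastic matrix -/

/-- The mass of row `e` in the positions `< k`. -/
def massBefore {U : Type} {n : ℕ} (A : Matrix U (Fin n) ℝ) (e : U) (k : ℕ) : ℝ :=
  ∑ i : Fin n, if (i : ℕ) < k then A e i else 0

/-- The distribution function of the first `1 / r` of the mass of row `e`, scaled to total mass
one. -/
def quantileCDF {U : Type} {n : ℕ} (r : ℝ) (A : Matrix U (Fin n) ℝ) (e : U) (k : ℕ) : ℝ :=
  min 1 (r * massBefore A e k)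

section Quantile

variable {U : Type} {n : ℕ} {A B : Matrix U (Fin n) ℝ} {r : ℝ}

theorem massBefore_succ (A : Matrix U (Fin n) ℝ) (e : U) (j : Fin n) :
    massBefore A e (j + 1) = massBefore A e j + A e j := by
  have : A e j = ∑ i : Fin n, if i = j then A e i else 0 := by simp
  rw [massBefore, massBefore, this, ← Finset.sum_add_distrib]
  refine Finset.sum_congr rfl fun i _ => ?_
  rcases lt_trichotomy i j with h | h | h
  · have h' : (i : ℕ) < j := h
    simp [h.ne, h', h'.trans (Nat.lt_succ_self _)]
  · simp [h]
  · have h' : (j : ℕ) < i := h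
    simp [h.ne', not_lt.2 h'.le, not_lt.2 (Nat.succ_le_of_lt h')]

theorem massBefore_mono (hA : ∀ e i, 0 ≤ A e i) (e : U) : Monotone (massBefore A e) := by
  intro k l hkl
  refine Finset.sum_le_sum fun i _ => ?_
  split_ifs with h1 h2
  · exact le_rfl
  · exact absurd (h1.trans_le hkl) h2
  · exact hA e i
  · exact le_rfl

theorem massBefore_zero (A : Matrix U (Fin n) ℝ) (e : U) : massBefore A e 0 = 0 := by
  simp [massBefore]

theorem massBefore_eq_sum (A : Matrix U (Fin n) ℝ) (e : U) : massBefore A e n = ∑ i, A e i := by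
  simp [massBefore]

/-- Keeping only `1 / r` of the mass of every row scales the column sums by at most `r`. -/
theorem isProfile_quantileCDF [Fintype U] (hr : 1 ≤ r) (hA : ∀ e i, 0 ≤ A e i)
    (hrow : ∀ e, ∑ i, A e i = 1) (hcol : ∀ i, ∑ e, A e i = 1) :
    IsProfile n r (quantileCDF r A) where
  zero e := by simp [quantileCDF, massBefore_zero]
  one e := by simp [quantileCDF, massBefore_eq_sum, hrow, hr]
  mono e k l hkl := min_le_min le_rfl
    (mul_le_mul_of_nonneg_left (massBefore_mono hA e hkl) (zero_le_one.trans hr))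
  le_one e k := min_le_left _ _
  load j hj := by
    have h : ∀ e, quantileCDF r A e (j + 1) - quantileCDF r A e j ≤ r * A e ⟨j, hj⟩ := by
      intro e
      have h1 := massBefore_succ A e ⟨j, hj⟩
      have h2 : 0 ≤ r * A e ⟨j, hj⟩ := mul_nonneg (zero_le_one.trans hr) (hA _ _)
      simp only at h1
      rw [quantileCDF, quantileCDF, h1, mul_add, sub_le_iff_le_add, ← min_add_add_left]
      exact min_le_min (by linarith) (by linarith)
    refine (Finset.sum_le_sum fun e _ => h e).trans ?_
    rw [← Finset.mul_sum, hcol, mul_one]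

/-- An element that the rounding may choose has its lower `1 / r`-quantile in the first
position. -/
theorem quantileCDF_one [NeZero n] (hr : 0 < r) {e : U} (he : 1 / r ≤ A e 0) :
    quantileCDF r A e 1 = 1 := by
  have h := massBefore_succ A e 0
  simp only [Fin.val_zero, massBefore_zero, zero_add] at h
  rw [quantileCDF, h, min_eq_left]
  rwa [div_le_iff₀' hr] at he

/-- A permutation agrees with the order of its own matrix on every pair; this is the value of the
potential at the start. -/
theorem potential_permMatrix [Fintype U] (hr : 1 ≤ r) (π : U ≃ Fin n) :
    potential π (quantileCDF r (permMatrix π)) = 0 := by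
  have hq : ∀ e k, quantileCDF r (permMatrix π) e k = if (π e : ℕ) < k then 1 else 0 := by
    intro e k
    have : massBefore (permMatrix π) e k = if (π e : ℕ) < k then 1 else 0 := by
      rw [massBefore, Finset.sum_eq_single (π e)]
      · simp [permMatrix]
      · intro i _ hi
        simp [permMatrix, hi.symm]
      · simp
    rw [quantileCDF, this]
    split_ifs <;> simp [hr]
  refine Finset.sum_eq_zero fun a _ => Finset.sum_eq_zero fun b _ => ?_
  split_ifs with hab
  · refine Finset.sum_eq_zero fun j _ => ?_
    rw [Fin.lt_def] at hab
    simp only [hq]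
    split_ifs <;> first | omega | simp
  · rfl

theorem sum_abs_indicator_sub_le (N i j : ℕ) :
    ∑ k ∈ Finset.range N, |(if i < k then (1 : ℝ) else 0) - (if j < k then 1 else 0)| ≤
      |(i : ℝ) - j| := by
  wlog hij : i ≤ j generalizing i j
  · have h := this j i (le_of_not_ge hij)
    rw [abs_sub_comm (i : ℝ)]
    refine le_of_eq_of_le (Finset.sum_congr rfl fun k _ => abs_sub_comm _ _) h
  have h1 : ∀ k, |(if i < k then (1 : ℝ) else 0) - (if j < k then 1 else 0)| =
      if k ∈ Finset.Ioc i j then 1 else 0 := by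
    intro k
    simp only [Finset.mem_Ioc]
    split_ifs <;> first | omega | simp
  have h2 : |(i : ℝ) - j| = ((Finset.Ioc i j).card : ℝ) := by
    rw [Nat.card_Ioc, Nat.cast_sub hij, abs_sub_comm, abs_of_nonneg]
    exact sub_nonneg.2 (Nat.cast_le.2 hij)
  rw [Finset.sum_congr rfl fun k _ => h1 k, ← Finset.sum_filter, Finset.sum_const,
    nsmul_eq_mul, mul_one, h2]
  refine Nat.cast_le.2 (Finset.card_le_card fun k hk => (Finset.mem_filter.1 hk).2)

/-- Transporting row `e` of `A` to row `e` of `B` costs at least the `L¹` distance of their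
distribution functions. -/
theorem sum_abs_massBefore_sub_le {f : U → Fin n → Fin n → ℝ} (hf : IsTransport A B f) (e : U)
    (N : ℕ) : ∑ k ∈ Finset.range N, |massBefore A e k - massBefore B e k| ≤
      ∑ i : Fin n, ∑ j : Fin n, |((i : ℕ) : ℝ) - ((j : ℕ) : ℝ)| * f e i j := by
  have h1 : ∀ k, massBefore A e k - massBefore B e k = ∑ i : Fin n, ∑ j : Fin n,
      ((if (i : ℕ) < k then (1 : ℝ) else 0) - (if (j : ℕ) < k then 1 else 0)) * f e i j := by
    intro k
    simp only [sub_mul, Finset.sum_sub_distrib]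
    congr 1
    · refine Finset.sum_congr rfl fun i _ => ?_
      rw [← Finset.mul_sum, hf.leave]
      simp
    · rw [Finset.sum_comm]
      refine Finset.sum_congr rfl fun j _ => ?_
      rw [← Finset.mul_sum, hf.arrive]
      simp
  calc ∑ k ∈ Finset.range N, |massBefore A e k - massBefore B e k|
      ≤ ∑ k ∈ Finset.range N, ∑ i : Fin n, ∑ j : Fin n,
          |(if (i : ℕ) < k then (1 : ℝ) else 0) - (if (j : ℕ) < k then 1 else 0)| * f e i j := by
        refine Finset.sum_le_sum fun k _ => ?_
        rw [h1]
        refine (Finset.abs_sum_le_sum_abs _ _).trans (Finset.sum_le_sum fun i _ =>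
          (Finset.abs_sum_le_sum_abs _ _).trans (le_of_eq (Finset.sum_congr rfl fun j _ => ?_)))
        rw [abs_mul, abs_of_nonneg (hf.nonneg e i j)]
    _ = ∑ i : Fin n, ∑ j : Fin n, (∑ k ∈ Finset.range N,
          |(if (i : ℕ) < k then (1 : ℝ) else 0) - (if (j : ℕ) < k then 1 else 0)|) *
            f e i j := by
        rw [Finset.sum_comm]
        refine Finset.sum_congr rfl fun i _ => ?_
        rw [Finset.sum_comm]
        exact Finset.sum_congr rfl fun j _ => (Finset.sum_mul _ _ _).symm
    _ ≤ _ := Finset.sum_le_sum fun i _ => Finset.sum_le_sum fun j _ =>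
        mul_le_mul_of_nonneg_right (sum_abs_indicator_sub_le N i j) (hf.nonneg e i j)

theorem abs_quantileCDF_sub_le (hr : 0 ≤ r) (e : U) (k : ℕ) :
    |quantileCDF r A e k - quantileCDF r B e k| ≤
      r * |massBefore A e k - massBefore B e k| := by
  refine (abs_min_sub_min_le_max _ _ _ _).trans ?_
  rw [sub_self, abs_zero, ← mul_sub, abs_mul, abs_of_nonneg hr]
  exact max_le (mul_nonneg hr (abs_nonneg _)) le_rfl

theorem sum_abs_quantileCDF_sub_le [Fintype U] (hr : 0 ≤ r) {f : U → Fin n → Fin n → ℝ}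
    (hf : IsTransport A B f) (N : ℕ) :
    ∑ e, ∑ k ∈ Finset.range N, |quantileCDF r A e k - quantileCDF r B e k| ≤
      r * transportCost f := by
  rw [transportCost, Finset.mul_sum]
  refine Finset.sum_le_sum fun e _ => ?_
  refine (Finset.sum_le_sum fun k _ => abs_quantileCDF_sub_le hr e k).trans ?_
  rw [← Finset.mul_sum]
  exact mul_le_mul_of_nonneg_left (sum_abs_massBefore_sub_le hf e N) hr

end Quantile

/-! ### The approximation guarantee -/

theorem length_le_optCost {U : Type} [Fintype U] {n T : ℕ} {R : Fin T → Finset U} (π₀ : U ≃ Fin n)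
    (hR : ∀ t, (R t).Nonempty) : T ≤ optCost π₀ R := by
  obtain ⟨σ, -, hopt⟩ := exists_totalCost_eq_optCost π₀ R
  rw [hopt, totalCost]
  refine le_add_of_le_left ?_
  have h : ∀ t : Fin T, 1 ≤ coverCost (σ t.succ) (R t) := fun t => by
    obtain ⟨e, -, he⟩ := exists_mem_coverCost_eq (σ t.succ) (hR t)
    omega
  simpa using Finset.sum_le_sum fun t (_ : t ∈ Finset.univ) => h t

section Approximation

variable {U : Type} [Fintype U] {n T : ℕ} [NeZero n] {π₀ : U ≃ Fin n} {R : Fin T → Finset U}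
  {A : Fin (T + 1) → Matrix U (Fin n) ℝ}

/-- Amortization of the cost of each round by the drop of the potential: a round costs `1` for
covering and at most `r` beyond the drop caused by the move to the front, and the change of the
matrix raises the potential by at most `2 * r ^ 2` times the footrule distance. -/
theorem IsGreedyRounding.totalCost_le {r : ℕ} (hr : 1 ≤ r) (hA : IsFeasibleMTF π₀ R A)
    {π : Fin (T + 1) → (U ≃ Fin n)} (hπ : IsGreedyRounding r π₀ R A π) :
    (totalCost R π : ℝ) ≤ (1 + r) * T + 2 * r ^ 2 * movingCost A := by
  have hr1 : (1 : ℝ) ≤ r := mod_cast hr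
  have hr0 : (0 : ℝ) < r := by linarith
  obtain ⟨f, hf, hc⟩ := hA.exists_optimal_transports
  have hprof : ∀ t, IsProfile n (r : ℝ) (quantileCDF r (A t)) := fun t =>
    isProfile_quantileCDF hr1 (hA.entry_nonneg t) (hA.sum_row t) (hA.sum_col t)
  let Φ : Fin (T + 1) → ℝ := fun t => potential (π t) (quantileCDF r (A t))
  have hround : ∀ t : Fin T,
      ((coverCost (π t.succ) (R t) : ℕ) : ℝ) + (kendallTau (π t.succ) (π t.castSucc) : ℕ) ≤
      1 + r + 2 * r ^ 2 * transportCost (f t) + (Φ t.castSucc - Φ t.succ) := by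
    intro t
    obtain ⟨e, he, hw, hmove⟩ := hπ.2 t
    have h1 : ((coverCost (π t.succ) (R t) : ℕ) : ℝ) ≤ 1 := by
      rw [hmove]
      exact mod_cast coverCost_moveToFront_le _ he
    have h2 : ((kendallTau (π t.succ) (π t.castSucc) : ℕ) : ℝ) ≤ (π t.castSucc e : ℕ) := by
      rw [hmove]
      exact mod_cast kendallTau_moveToFront_le _ e
    have h3 := (hprof t.succ).potential_moveToFront_le (π t.castSucc) (quantileCDF_one hr0 hw)
    rw [← hmove] at h3
    have h4 := (hprof t.castSucc).potential_sub_le (hprof t.succ) (π t.castSucc)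
    have h5 := mul_le_mul_of_nonneg_left (sum_abs_quantileCDF_sub_le hr0.le (hf t) (n + 1))
      (by positivity : (0 : ℝ) ≤ 2 * r)
    simp only [Φ]
    nlinarith
  have htel : ∑ t : Fin T, (Φ t.castSucc - Φ t.succ) = Φ 0 - Φ (Fin.last T) := by
    have h1 := Fin.sum_univ_succ Φ
    have h2 := Fin.sum_univ_castSucc Φ
    rw [Finset.sum_sub_distrib]
    linarith
  have hΦ0 : Φ 0 = 0 := by
    simp only [Φ, hA.init, hπ.1]
    exact potential_permMatrix hr1 π₀
  have hΦT : 0 ≤ Φ (Fin.last T) := (hprof _).potential_nonneg _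
  have hsum := Finset.sum_le_sum fun t (_ : t ∈ Finset.univ) => hround t
  rw [totalCost, hc]
  push_cast
  simp only [Finset.sum_add_distrib, htel, hΦ0, ← Finset.mul_sum, Finset.sum_const,
    Finset.card_univ, Fintype.card_fin, nsmul_eq_mul] at hsum
  linarith

/-- Moving the first requested element to the front in every round turns an optimal sequence of
permutations into a feasible solution of Fractional-MTF. -/
theorem exists_isFeasibleMTF_movingCost_le (π₀ : U ≃ Fin n) (hR : ∀ t, (R t).Nonempty) :
    ∃ B, IsFeasibleMTF π₀ R B ∧ movingCost B ≤ 4 * (optCost π₀ R : ℝ) := by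
  obtain ⟨σ, h0, hopt⟩ := exists_totalCost_eq_optCost π₀ R
  choose e he hcov using fun t : Fin T => exists_mem_coverCost_eq (σ t.succ) (hR t)
  let τ : Fin (T + 1) → (U ≃ Fin n) := Fin.cases π₀ fun t => moveToFront (σ t.succ) (e t)
  -- `c t` bounds the Kendall tau distance of `τ t` and `σ t`; every `c t` is charged twice below,
  -- for the transition into `t` and for the one out of `t`
  let c : Fin (T + 1) → ℝ := Fin.cases 0 fun t => ((σ t.succ (e t) : ℕ) : ℝ)
  have hτσ : ∀ t, ∑ a, |((τ t a : ℕ) : ℝ) - ((σ t a : ℕ) : ℝ)| ≤ 2 * c t := by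
    intro t
    refine Fin.cases ?_ (fun t => ?_) t
    · simp [τ, c, h0]
    · refine (sum_abs_sub_le_kendallTau _ _).trans (mul_le_mul_of_nonneg_left ?_ zero_le_two)
      exact Nat.cast_le.2 (kendallTau_moveToFront_le (σ t.succ) (e t))
  refine ⟨fun t => permMatrix (τ t), isFeasibleMTF_permMatrix rfl fun t =>
    ⟨e t, he t, moveToFront_self _ _⟩, ?_⟩
  have hround : ∀ t : Fin T, footrule (permMatrix (τ t.succ)) (permMatrix (τ t.castSucc)) ≤
      2 * c t.succ + 2 * (kendallTau (σ t.succ) (σ t.castSucc) : ℝ) + 2 * c t.castSucc := by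
    intro t
    refine (footrule_permMatrix_le _ _).trans ?_
    refine le_trans ?_ (add_le_add (add_le_add (hτσ t.succ)
      (sum_abs_sub_le_kendallTau (σ t.succ) (σ t.castSucc))) (hτσ t.castSucc))
    rw [← Finset.sum_add_distrib, ← Finset.sum_add_distrib]
    refine Finset.sum_le_sum fun a _ => ?_
    have h1 := abs_sub_le ((τ t.succ a : ℕ) : ℝ) (σ t.succ a : ℕ) (τ t.castSucc a : ℕ)
    have h2 := abs_sub_le ((σ t.succ a : ℕ) : ℝ) (σ t.castSucc a : ℕ) (τ t.castSucc a : ℕ)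
    rw [abs_sub_comm ((σ t.castSucc a : ℕ) : ℝ)] at h2
    linarith
  have hc : ∑ t : Fin T, c t.castSucc ≤ ∑ t : Fin T, c t.succ := by
    have h1 := Fin.sum_univ_succ c
    have h2 := Fin.sum_univ_castSucc c
    have h3 : c 0 = 0 := rfl
    have h4 : 0 ≤ c (Fin.last T) :=
      Fin.cases (motive := fun t => 0 ≤ c t) le_rfl (fun _ => Nat.cast_nonneg _) (Fin.last T)
    linarith
  have hcover : ∑ t : Fin T, c t.succ ≤ ∑ t : Fin T, ((coverCost (σ t.succ) (R t) : ℕ) : ℝ) := by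
    refine Finset.sum_le_sum fun t _ => ?_
    rw [hcov]
    push_cast
    exact le_add_of_nonneg_right zero_le_one
  have hsum := Finset.sum_le_sum fun t (_ : t ∈ Finset.univ) => hround t
  simp only [Finset.sum_add_distrib, ← Finset.mul_sum] at hsum
  have hk : 0 ≤ ∑ t : Fin T, ((kendallTau (σ t.succ) (σ t.castSucc) : ℕ) : ℝ) :=
    Finset.sum_nonneg fun _ _ => Nat.cast_nonneg _
  rw [hopt, totalCost]
  push_cast
  refine hsum.trans ?_
  linarith

theorem IsGreedyRounding.totalCost_le_optCost {r : ℕ} (hR : ∀ t, (R t).Nonempty)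
    (hr : ∀ t, (R t).card ≤ r) (hA : IsOptimalMTF π₀ R A) {π : Fin (T + 1) → (U ≃ Fin n)}
    (hπ : IsGreedyRounding r π₀ R A π) :
    (totalCost R π : ℝ) ≤ 10 * (r : ℝ) ^ 2 * (optCost π₀ R : ℝ) := by
  -- without rounds, `r` may be `0`, and both costs vanish
  obtain rfl | hT := Nat.eq_zero_or_pos T
  · have : totalCost R π = 0 := by simp [totalCost]
    rw [this, Nat.cast_zero]
    positivity
  have hr1 : 1 ≤ r := (hR ⟨0, hT⟩).card_pos.trans_le (hr _)
  have hr1' : (1 : ℝ) ≤ r := mod_cast hr1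
  obtain ⟨B, hB, hBc⟩ := exists_isFeasibleMTF_movingCost_le π₀ hR
  have h1 := hπ.totalCost_le hr1 hA.1
  have h2 : movingCost A ≤ 4 * (optCost π₀ R : ℝ) := (hA.2 B hB).trans hBc
  have h3 : (T : ℝ) ≤ optCost π₀ R := mod_cast length_le_optCost π₀ hR
  have h4 : (0 : ℝ) ≤ optCost π₀ R := Nat.cast_nonneg _
  calc (totalCost R π : ℝ) ≤ (1 + r) * T + 2 * r ^ 2 * movingCost A := h1
    _ ≤ (1 + r) * optCost π₀ R + 2 * r ^ 2 * (4 * optCost π₀ R) := by gcongr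
    _ = (1 + r + 8 * r ^ 2) * optCost π₀ R := by ring
    _ ≤ 10 * (r : ℝ) ^ 2 * optCost π₀ R :=
      mul_le_mul_of_nonneg_right (by nlinarith) h4

end Approximation

/-! ### The greedy rounding algorithm -/

theorem exists_isGreedyRounding {U : Type} {n T r : ℕ} [NeZero n] (π₀ : U ≃ Fin n)
    {R : Fin T → Finset U} {A : Fin (T + 1) → Matrix U (Fin n) ℝ}
    (h : ∀ t, ∃ e ∈ R t, 1 / (r : ℝ) ≤ A t.succ e 0) :
    ∃ π, IsGreedyRounding r π₀ R A π := by
  choose e he hw using h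
  let π : Fin (T + 1) → (U ≃ Fin n) :=
    Fin.induction π₀ fun t σ => moveToFront σ (e t)
  exact ⟨π, rfl, fun t => ⟨e t, he t, hw t, Fin.induction_succ _ _ _⟩⟩

section Algorithm

variable {U : Type} [Fintype U] [DecidableEq U] {n T : ℕ} [NeZero n]

/-- Correctness and running time of the algorithm. Each round costs at most `3 * n + 4` steps; the
size of the linear program dominates. -/
theorem greedyAlgorithm_spec {r : ℕ} (π₀ : U ≃ Fin n) {L : Fin T → List U}
    (hL : ∀ t, (L t).Nodup) (hR : ∀ t, (L t).toFinset.Nonempty)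
    (hr : ∀ t, (L t).toFinset.card ≤ r)
    {solve : (P : LinearProgram) → Timed (P.Var → ℝ)} (hsolve : SolvesLP solve) :
    (∃ A π, IsOptimalMTF π₀ (fun t => (L t).toFinset) A ∧
      IsGreedyRounding r π₀ (fun t => (L t).toFinset) A π ∧
      (greedyAlgorithm solve r π₀ L).val = List.ofFn fun t : Fin T => listing (π t.succ)) ∧
    (greedyAlgorithm solve r π₀ L).steps ≤
      (solve (mtfLP π₀ fun t => (L t).toFinset)).steps + 50 * (T + 1) ^ 2 * (n + 1) ^ 5 := by
  have hx := hsolve _ (exists_isOptimal_mtfLP (π₀ := π₀) hR)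
  have hA := isOptimalMTF_of_mtfLP hx
  have hheavy := fun t => hA.1.exists_heavy t (hR t) (hr t)
  have hlen : ∀ t, (L t).length ≤ n := fun t => by
    rw [← List.toFinset_card_of_nodup (hL t)]
    exact (Finset.card_le_univ _).trans (by simpa using (Fintype.card_congr π₀).le)
  obtain ⟨π, h0, hπ, hval, hsteps⟩ := roundAll_listing (θ := 1 / (r : ℝ))
    (fun t e => (solve (mtfLP π₀ fun t => (L t).toFinset)).val (.inl (t.succ, e, 0))) L π₀
    (fun t => by simpa using hheavy t) hlen
  refine ⟨⟨_, π, hA, ⟨h0, fun t => by simpa using hπ t⟩, hval⟩, ?_⟩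
  have hbits := bitSize_mtfLP_le π₀ fun t => (L t).toFinset
  have hrounds : T * (n + 2 * n + 4) ≤ 4 * ((T + 1) ^ 2 * (n + 1) ^ 5) := by
    calc T * (n + 2 * n + 4) ≤ (T + 1) * (4 * (n + 1)) := by gcongr <;> omega
      _ = 4 * ((T + 1) * (n + 1)) := by ring
      _ ≤ 4 * ((T + 1) ^ 2 * (n + 1) ^ 5) := by
        gcongr
        · exact Nat.le_self_pow two_ne_zero _
        · exact Nat.le_self_pow (by norm_num) _
  calc (greedyAlgorithm solve r π₀ L).steps
      ≤ 38 * (T + 1) ^ 2 * (n + 1) ^ 5 + ((solve (mtfLP π₀ fun t => (L t).toFinset)).steps +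
          T * (n + 2 * n + 4)) := add_le_add hbits (add_le_add le_rfl hsteps)
    _ ≤ _ := by nlinarith

end Algorithm

end MultMSSC

end

theorem theorem3 :
    ∃ (C : ℝ) (D : ℕ), 0 < C ∧
      ∀ (U : Type) [Fintype U] [DecidableEq U] (n T r : ℕ) [NeZero n]
        (π₀ : U ≃ Fin n) (R : Fin T → Finset U),
        (∀ t, (R t).Nonempty) → (∀ t, (R t).card ≤ r) →
        -- Fractional-MTF has an optimal solution
        (∃ A, MultMSSC.IsOptimalMTF π₀ R A) ∧
        -- every optimal solution can be rounded, and each way of rounding it is `O(r²)`-approximate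
        (∀ A, MultMSSC.IsOptimalMTF π₀ R A →
          (∀ t : Fin T, ∃ e ∈ R t, 1 / (r : ℝ) ≤ A t.succ e 0) ∧
          (∃ π, MultMSSC.IsGreedyRounding r π₀ R A π) ∧
          ∀ π, MultMSSC.IsGreedyRounding r π₀ R A π →
            (MultMSSC.totalCost R π : ℝ) ≤ C * (r : ℝ) ^ 2 * (MultMSSC.optCost π₀ R : ℝ)) ∧
        -- running time: one linear program of polynomial size, and polynomially many steps
        (MultMSSC.mtfLP π₀ R).bitSize ≤ D * (T + 1) ^ 2 * (n + 1) ^ 5 ∧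
        ∀ solve : (P : MultMSSC.LinearProgram) → MultMSSC.Timed (P.Var → ℝ),
          MultMSSC.SolvesLP solve →
          ∀ L : Fin T → List U, (∀ t, (L t).Nodup ∧ (L t).toFinset = R t) →
            (∃ A π, MultMSSC.IsOptimalMTF π₀ R A ∧ MultMSSC.IsGreedyRounding r π₀ R A π ∧
              (MultMSSC.greedyAlgorithm solve r π₀ L).val =
                List.ofFn fun t : Fin T => MultMSSC.listing (π t.succ)) ∧
            (MultMSSC.greedyAlgorithm solve r π₀ L).steps ≤
              (solve (MultMSSC.mtfLP π₀ R)).steps + D * (T + 1) ^ 2 * (n + 1) ^ 5 := by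
  refine ⟨10, 50, by norm_num, ?_⟩
  intro U _ _ n T r _ π₀ R hR hr
  refine ⟨?_, fun A hA => ?_, ?_, fun solve hsolve L hL => ?_⟩
  · obtain ⟨x, hx⟩ := MultMSSC.exists_isOptimal_mtfLP (π₀ := π₀) hR
    exact ⟨_, MultMSSC.isOptimalMTF_of_mtfLP hx⟩
  · have hheavy := fun t => hA.1.exists_heavy t (hR t) (hr t)
    exact ⟨hheavy, MultMSSC.exists_isGreedyRounding π₀ hheavy,
      fun π hπ => hπ.totalCost_le_optCost hR hr hA⟩
  · refine (MultMSSC.bitSize_mtfLP_le π₀ R).trans ?_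
    gcongr
    norm_num
  · obtain rfl : (fun t => (L t).toFinset) = R := funext fun t => (hL t).2
    exact MultMSSC.greedyAlgorithm_spec π₀ (fun t => (hL t).1) hR hr hsolve
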